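/- Let $n\ge 0$, $J=\begin{pmatrix}0&I_n\\-I_n&0\end{pmatrix}$, $\mathrm{Sp}(2n,\mathbb C)=\{g\in \mathrm{GL}(2n,\mathbb C): g^TJg=J\}$, $\mathfrak{sp}(2n,\mathbb C)=\{X\in \mathrm M(2n,\mathbb C): X^TJ=-JX\}$, and let $\mathrm{PSp}(2n,\mathbb C)=\mathrm{Sp}(2n,\mathbb C)/\{\pm I_{2n}\}$, a complex Lie group. Then: 1. For every $X\in\mathfrak{sp}(2n,\mathbb C)$ there is a symplectic skew-involution, that is, some $g\in\mathrm{Sp}(2n,\mathbb C)$ with $g^2=-I_{2n}$, such that $gXg^{-1}=-X$. 2. Every element $X$ of the Lie algebra $\mathrm{Lie}(\mathrm{PSp}(2n,\mathbb C))$ is strongly $\mathrm{Ad}_{\mathrm{PSp}(2n,\mathbb C)}$-real: there is $h\in\mathrm{PSp}(2n,\mathbb C)$ with $h^2=1$ and $\mathrm{Ad}(h)X=-X$, where $\mathrm{Ad}(h)$ is the differential at the identity of $x\mapsto hxh^{-1}$. 3. Every $X\in\mathfrak{sp}(2n,\mathbb C)$ is $\mathrm{Ad}_{\mathrm{Sp}(2n,\mathbb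 C)}$-real: there is $g\in\mathrm{Sp}(2n,\mathbb C)$ with $gXg^{-1}=-X$. -/

import Mathlib

open scoped Manifold ContDiff Matrix.Norms.L2Operator

namespace SymplecticReality

open Matrix Topology Set

noncomputable section


attribute [local instance 100] LieRing.ofAssociativeRing

/-- `2n × 2n` complex matrices, in `n × n` blocks. -/
abbrev Mat (n : ℕ) : Type := Matrix (Fin n ⊕ Fin n) (Fin n ⊕ Fin n) ℂ

/-- `Sp(2n, ℂ)`: the matrices `g` with `g J gᵀ = J`, equivalently `gᵀ J g = J`. Mathlib's `J` is
`!![0, -I; I, 0]`; replacing `J` by `-J` changes neither `Sp(2n, ℂ)` nor `sp(2n, ℂ)`. -/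
abbrev Sp (n : ℕ) : Submonoid (Mat n) := Matrix.symplecticGroup (Fin n) ℂ

/-- `sp(2n, ℂ)`: the Hamiltonian matrices, `Xᵀ J = -J X`, as a complex vector space. -/
abbrev sp (n : ℕ) : Submodule ℂ (Mat n) := (LieAlgebra.Symplectic.sp (Fin n) ℂ).toSubmodule

theorem mem_sp {n : ℕ} {X : Mat n} :
    X ∈ sp n ↔ Xᵀ * Matrix.J (Fin n) ℂ = -(Matrix.J (Fin n) ℂ * X) := by
  rw [← Matrix.mul_neg]
  exact (mem_skewAdjointMatricesLieSubalgebra (Matrix.J (Fin n) ℂ) X).trans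
    (mem_skewAdjointMatricesSubmodule _ _)

instance (n : ℕ) : IsTopologicalGroup (Sp n) where
  continuous_inv := by
    refine Continuous.subtype_mk ?_ _
    fun_prop

/-- The central subgroup `{I, -I}` of `Sp(2n, ℂ)`. -/
def signs (n : ℕ) : Subgroup (Sp n) where
  carrier := {g | (g : Mat n) = 1 ∨ (g : Mat n) = -1}
  one_mem' := Or.inl rfl
  mul_mem' := by
    rintro a b (ha | ha) (hb | hb) 
    · exact Or.inl (by simp [ha, hb])
    · exact Or.inr (by simp [ha, hb])
    · exact Or.inr (by simp [ha, hb])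
    · exact Or.inl (by simp [ha, hb])
  inv_mem' := by
    rintro a (ha | ha) 
    · exact Or.inl (by simp [SymplecticGroup.coe_inv', ha])
    · right
      rw [SymplecticGroup.coe_inv', ha]
      exact Matrix.inv_eq_left_inv (by simp)

instance (n : ℕ) : (signs n).Normal where
  conj_mem := by
    rintro a (ha | ha) g
    · have : a = 1 := Subtype.ext ha
      subst this
      simp [one_mem]
    · right
      have h : (g : Mat n) * ((g⁻¹ : Sp n) : Mat n) = 1 := congrArg Subtype.val (mul_inv_cancel g)
      simp [ha, h]

/-- `PSp(2n, ℂ) = Sp(2n, ℂ) / {I, -I}`, with the quotient group structure and the quotient topology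
of the topology of `Sp(2n, ℂ)` as a set of matrices. -/
abbrev PSp (n : ℕ) : Type := Sp n ⧸ signs n


variable {n : ℕ}

theorem transpose_one_add {X : Mat n} (hX : X ∈ sp n) :
    (1 + X)ᵀ * Matrix.J (Fin n) ℂ = Matrix.J (Fin n) ℂ * (1 - X) := by
  rw [transpose_add, transpose_one, add_mul, mem_sp.1 hX, one_mul, mul_sub, mul_one,
    sub_eq_add_neg]

theorem transpose_one_sub {X : Mat n} (hX : X ∈ sp n) :
    (1 - X)ᵀ * Matrix.J (Fin n) ℂ = Matrix.J (Fin n) ℂ * (1 + X) := by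
  rw [transpose_sub, transpose_one, sub_mul, mem_sp.1 hX, one_mul, mul_add, mul_one, sub_neg_eq_add]

theorem cayley_mem {X : Mat n} (hX : X ∈ sp n) (h : IsUnit (1 - X)) :
    (1 + X) * (1 - X)⁻¹ ∈ Sp n := by
  have h1 : IsUnit (1 - X).det := (isUnit_iff_isUnit_det _).1 h
  have h2 : IsUnit ((1 - X)ᵀ).det := by rwa [det_transpose]
  rw [SymplecticGroup.mem_iff', transpose_mul, transpose_nonsing_inv]
  have hc : (1 - X) * (1 + X) = (1 + X) * (1 - X) := by noncomm_ring
  calc ((1 - X)ᵀ)⁻¹ * (1 + X)ᵀ * J (Fin n) ℂ * ((1 + X) * (1 - X)⁻¹)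
      = ((1 - X)ᵀ)⁻¹ * ((1 + X)ᵀ * J (Fin n) ℂ) * ((1 + X) * (1 - X)⁻¹) := by
        simp only [Matrix.mul_assoc]
    _ = ((1 - X)ᵀ)⁻¹ * J (Fin n) ℂ * ((1 - X) * (1 + X)) * (1 - X)⁻¹ := by
        rw [transpose_one_add hX]; simp only [Matrix.mul_assoc]
    _ = ((1 - X)ᵀ)⁻¹ * (J (Fin n) ℂ * (1 + X)) * ((1 - X) * (1 - X)⁻¹) := by
        rw [hc]; simp only [Matrix.mul_assoc]
    _ = J (Fin n) ℂ := by
        rw [← transpose_one_sub hX, mul_nonsing_inv _ h1, ← Matrix.mul_assoc,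
          nonsing_inv_mul _ h2, one_mul, mul_one]

open Classical in
/-- The Cayley transform `X ↦ (1 + X)(1 - X)⁻¹` from `sp(2n, ℂ)` to `Sp(2n, ℂ)`; the value `1` where
`1 - X` is not invertible is never used. -/
def cayley (X : sp n) : Sp n :=
  if h : IsUnit (1 - (X : Mat n)) then ⟨(1 + (X : Mat n)) * (1 - (X : Mat n))⁻¹, cayley_mem X.2 h⟩
  else 1

theorem coe_cayley {X : sp n} (h : IsUnit (1 - (X : Mat n))) :
    (cayley X : Mat n) = (1 + (X : Mat n)) * (1 - (X : Mat n))⁻¹ := by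
  rw [cayley, dif_pos h]

theorem isUnit_of_mem_ball {X : sp n} (hX : X ∈ Metric.ball (0 : sp n) 1) :
    IsUnit (1 - (X : Mat n)) :=
  isUnit_one_sub_of_norm_lt_one (by simpa using hX)

theorem proj_mem (A : Mat n) :
    (2⁻¹ : ℂ) • (A + Matrix.J (Fin n) ℂ * Aᵀ * Matrix.J (Fin n) ℂ) ∈ sp n := by
  refine Submodule.smul_mem _ _ ?_
  rw [mem_sp]
  have h := J_squared (Fin n) ℂ
  simp only [transpose_add, transpose_mul, J_transpose, transpose_transpose, add_mul, mul_add,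
    neg_mul, mul_neg, neg_neg]
  simp only [Matrix.mul_assoc, h]
  simp only [← Matrix.mul_assoc, h]
  simp

theorem proj_eq {X : Mat n} (hX : X ∈ sp n) :
    (2⁻¹ : ℂ) • (X + Matrix.J (Fin n) ℂ * Xᵀ * Matrix.J (Fin n) ℂ) = X := by
  rw [Matrix.mul_assoc, mem_sp.1 hX, mul_neg, ← Matrix.mul_assoc, J_squared, neg_mul, neg_neg,
    one_mul, ← two_smul ℂ X, smul_smul]
  simp

/-- The projection of all matrices onto `sp(2n, ℂ)` along the skew-Hamiltonian matrices. -/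
def proj (n : ℕ) : Mat n →L[ℂ] sp n :=
  LinearMap.toContinuousLinearMap
    { toFun A := ⟨(2⁻¹ : ℂ) • (A + Matrix.J (Fin n) ℂ * Aᵀ * Matrix.J (Fin n) ℂ), proj_mem A⟩
      map_add' A B := Subtype.ext <| by
        simp only [transpose_add, mul_add, add_mul, Submodule.coe_add, ← smul_add]
        congr 1
        abel
      map_smul' c A := Subtype.ext <| by
        simp only [transpose_smul, Matrix.mul_smul, Matrix.smul_mul, ← smul_add, RingHom.id_apply,
          Submodule.coe_smul]
        rw [smul_comm] }

theorem proj_coe (X : sp n) : proj n X = X := Subtype.ext (proj_eq X.2)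

/-- The inverse Cayley transform `g ↦ (g - 1)(g + 1)⁻¹`, extended to all matrices by means of the
projection. -/
def cayleyInv (g : Mat n) : sp n := proj n ((g - 1) * (g + 1)⁻¹)

theorem cayley_add_one {X : Mat n} (h : IsUnit (1 - X)) :
    (1 + X) * (1 - X)⁻¹ + 1 = (2 : ℂ) • (1 - X)⁻¹ := by
  have h1 : IsUnit (1 - X).det := (isUnit_iff_isUnit_det _).1 h
  have e := mul_nonsing_inv _ h1
  rw [sub_mul, one_mul] at e
  rw [add_mul, one_mul]
  generalize (1 - X)⁻¹ = U at *
  rw [← e, two_smul]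
  abel

theorem cayley_sub_one {X : Mat n} (h : IsUnit (1 - X)) :
    (1 + X) * (1 - X)⁻¹ - 1 = (2 : ℂ) • (X * (1 - X)⁻¹) := by
  have h1 : IsUnit (1 - X).det := (isUnit_iff_isUnit_det _).1 h
  have e := mul_nonsing_inv _ h1
  rw [sub_mul, one_mul] at e
  rw [add_mul, one_mul]
  generalize (1 - X)⁻¹ = U at *
  rw [← e, two_smul]
  abel

theorem isUnit_cayley_add_one {X : sp n} (h : IsUnit (1 - (X : Mat n))) :
    IsUnit ((cayley X : Mat n) + 1) := by
  have h1 : IsUnit (1 - (X : Mat n)).det := (isUnit_iff_isUnit_det _).1 h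
  rw [coe_cayley h, cayley_add_one h, isUnit_iff_isUnit_det, det_smul]
  refine IsUnit.mul (by simp) ?_
  rwa [isUnit_nonsing_inv_det_iff]

theorem cayleyInv_cayley {X : sp n} (h : IsUnit (1 - (X : Mat n))) :
    cayleyInv (cayley X : Mat n) = X := by
  have h1 : IsUnit (1 - (X : Mat n)).det := (isUnit_iff_isUnit_det _).1 h
  rw [cayleyInv]
  convert proj_coe X
  have h2 := (isUnit_iff_isUnit_det _).1 (isUnit_cayley_add_one h)
  have e : (cayley X : Mat n) - 1 = X * ((cayley X : Mat n) + 1) := by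
    rw [coe_cayley h, cayley_sub_one h, cayley_add_one h, Matrix.mul_smul]
  rw [e, Matrix.mul_assoc, mul_nonsing_inv _ h2, mul_one]

theorem cayleyInv_aux {g : Sp n} (h : IsUnit ((g : Mat n) + 1)) :
    ((g : Mat n) - 1) * ((g : Mat n) + 1)⁻¹ ∈ sp n := by
  have h1 : IsUnit ((g : Mat n) + 1).det := (isUnit_iff_isUnit_det _).1 h
  have h2 : IsUnit (((g : Mat n) + 1)ᵀ).det := by rwa [det_transpose]
  have hg := SymplecticGroup.mem_iff'.1 g.2
  generalize (g : Mat n) = g at *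
  have key : (g - 1)ᵀ * J (Fin n) ℂ * (g + 1) = - ((g + 1)ᵀ * J (Fin n) ℂ * (g - 1)) := by
    simp only [transpose_sub, transpose_add, transpose_one, sub_mul, add_mul, mul_add, mul_sub,
      hg, one_mul, mul_one]
    abel
  rw [mem_sp, transpose_mul, transpose_nonsing_inv]
  calc ((g + 1)ᵀ)⁻¹ * (g - 1)ᵀ * J (Fin n) ℂ
      = ((g + 1)ᵀ)⁻¹ * ((g - 1)ᵀ * J (Fin n) ℂ * (g + 1)) * (g + 1)⁻¹ := by
        simp only [Matrix.mul_assoc]; rw [mul_nonsing_inv _ h1, mul_one]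
    _ = -((((g + 1)ᵀ)⁻¹ * (g + 1)ᵀ) * (J (Fin n) ℂ * ((g - 1) * (g + 1)⁻¹))) := by
        rw [key]; simp only [Matrix.mul_assoc, mul_neg, neg_mul]
    _ = -(J (Fin n) ℂ * ((g - 1) * (g + 1)⁻¹)) := by rw [nonsing_inv_mul _ h2, one_mul]

theorem coe_cayleyInv {g : Sp n} (h : IsUnit ((g : Mat n) + 1)) :
    (cayleyInv (g : Mat n) : Mat n) = ((g : Mat n) - 1) * ((g : Mat n) + 1)⁻¹ :=
  congrArg Subtype.val (proj_coe ⟨_, cayleyInv_aux h⟩)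

theorem one_sub_cayleyInv {g : Sp n} (h : IsUnit ((g : Mat n) + 1)) :
    1 - (cayleyInv (g : Mat n) : Mat n) = (2 : ℂ) • ((g : Mat n) + 1)⁻¹ := by
  have h1 : IsUnit ((g : Mat n) + 1).det := (isUnit_iff_isUnit_det _).1 h
  rw [coe_cayleyInv h]
  have e := mul_nonsing_inv _ h1
  rw [add_mul, one_mul] at e
  rw [sub_mul, one_mul]
  generalize ((g : Mat n) + 1)⁻¹ = U at *
  rw [← e, two_smul]
  abel

theorem cayley_cayleyInv {g : Sp n} (h : IsUnit ((g : Mat n) + 1)) :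
    cayley (cayleyInv (g : Mat n)) = g := by
  have h1 : IsUnit ((g : Mat n) + 1).det := (isUnit_iff_isUnit_det _).1 h
  have hu : IsUnit (1 - (cayleyInv (g : Mat n) : Mat n)) := by
    rw [one_sub_cayleyInv h, isUnit_iff_isUnit_det, det_smul]
    exact IsUnit.mul (by simp) (by rwa [isUnit_nonsing_inv_det_iff])
  have hu1 := (isUnit_iff_isUnit_det _).1 hu
  refine Subtype.ext ?_
  rw [coe_cayley hu]
  have e : 1 + (cayleyInv (g : Mat n) : Mat n) = (g : Mat n) * (1 - (cayleyInv (g : Mat n) : Mat n)) := by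
    rw [one_sub_cayleyInv h, coe_cayleyInv h, Matrix.mul_smul]
    nth_rw 1 [← mul_nonsing_inv _ h1]
    rw [← add_mul, two_smul, ← add_mul]
    congr 1
    abel
  rw [e, Matrix.mul_assoc, mul_nonsing_inv _ hu1, mul_one]


theorem mk_eq_mk {g h : Sp n} :
    (g : PSp n) = (h : PSp n) ↔ (h : Mat n) = g ∨ (h : Mat n) = -g := by
  have e : (h : Mat n) = (g : Mat n) * ((g⁻¹ * h : Sp n) : Mat n) :=
    congrArg Subtype.val (mul_inv_cancel_left g h).symm
  have e2 : ((g⁻¹ : Sp n) : Mat n) * (g : Mat n) = 1 := congrArg Subtype.val (inv_mul_cancel g)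
  rw [QuotientGroup.eq]
  constructor
  · rintro (h | h)
    · left; rw [e, h, mul_one]
    · right; rw [e, h, mul_neg, mul_one]
  · rintro (h | h)
    · left; rw [Submonoid.coe_mul, h, e2]
    · right; rw [Submonoid.coe_mul, h, mul_neg, e2]

/-- `X ↦ ± (1 + X)(1 - X)⁻¹`. -/
def param (X : sp n) : PSp n := (cayley X : PSp n)

theorem cayley_ne_neg {X Y : sp n} (hX : X ∈ Metric.ball (0 : sp n) 1)
    (hY : Y ∈ Metric.ball (0 : sp n) 1) (h : (cayley Y : Mat n) = -cayley X) : X = Y := by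
  have uX := isUnit_of_mem_ball hX
  have uY := isUnit_of_mem_ball hY
  have e : (X : Mat n) * Y = 1 := by
    have dX := (isUnit_iff_isUnit_det _).1 uX
    have dY := (isUnit_iff_isUnit_det _).1 uY
    rw [coe_cayley uX, coe_cayley uY] at h
    have c : (1 - (X : Mat n)) * ((1 + (X : Mat n)) * (1 - (X : Mat n))⁻¹) = 1 + X := by
      rw [← Matrix.mul_assoc, show (1 - (X : Mat n)) * (1 + (X : Mat n))
        = (1 + (X : Mat n)) * (1 - (X : Mat n)) by noncomm_ring, Matrix.mul_assoc,
        mul_nonsing_inv _ dX, mul_one]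
    have h' : (1 - (X : Mat n)) * (1 + (Y : Mat n)) = -((1 + (X : Mat n)) * (1 - (Y : Mat n))) := by
      have := congrArg (fun A => (1 - (X : Mat n)) * A * (1 - (Y : Mat n))) h
      simp only [mul_neg, c, neg_mul] at this
      rw [← this]
      simp only [Matrix.mul_assoc]
      rw [nonsing_inv_mul _ dY, mul_one]
    have h2 : (2 : ℂ) • ((X : Mat n) * Y) = (2 : ℂ) • 1 := by
      have : (1 - (X : Mat n)) * (1 + (Y : Mat n)) + ((1 + (X : Mat n)) * (1 - (Y : Mat n))) = 0 := by
        rw [h']; simp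
      have h3 : (1 - (X : Mat n)) * (1 + (Y : Mat n)) + ((1 + (X : Mat n)) * (1 - (Y : Mat n)))
        = (2 : ℂ) • 1 - (2 : ℂ) • ((X : Mat n) * Y) := by
        simp only [two_smul]; noncomm_ring
      rw [this] at h3
      exact (sub_eq_zero.1 h3.symm).symm
    exact smul_right_injective _ (two_ne_zero' ℂ) h2
  have hlt : ‖(X : Mat n) * Y‖ < 1 := by
    have hX' : ‖(X : Mat n)‖ < 1 := by simpa using hX
    have hY' : ‖(Y : Mat n)‖ < 1 := by simpa using hY
    exact (norm_mul_le _ _).trans_lt (mul_lt_one_of_nonneg_of_lt_one_left (norm_nonneg _) hX' hY'.le)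
  have hu := isUnit_one_sub_of_norm_lt_one hlt
  rw [e, sub_self, isUnit_zero_iff] at hu
  have := subsingleton_of_zero_eq_one hu
  exact Subtype.ext (Subsingleton.elim _ _)

theorem param_injOn : InjOn (param (n := n)) (Metric.ball 0 1) := by
  intro X hX Y hY h
  rcases mk_eq_mk.1 h with h | h
  · rw [← cayleyInv_cayley (isUnit_of_mem_ball hX), ← cayleyInv_cayley (isUnit_of_mem_ball hY), h]
  · exact cayley_ne_neg hX hY h

theorem contDiffAt_inv {A : Mat n} (h : IsUnit A) :
    ContDiffAt ℂ ω (fun A : Mat n => A⁻¹) A := by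
  have := contDiffAt_ringInverse (n := ω) ℂ h.unit
  simp only [nonsing_inv_eq_ringInverse]
  exact this

theorem contDiffAt_cayleyInv {g : Mat n} (h : IsUnit (g + 1)) :
    ContDiffAt ℂ ω (cayleyInv (n := n)) g := by
  refine (proj n).contDiff.contDiffAt.comp g ?_
  refine (contDiffAt_id.sub contDiffAt_const).mul ?_
  exact ContDiffAt.comp g (g := fun A : Mat n => A⁻¹) (contDiffAt_inv h)
    (contDiffAt_id.add contDiffAt_const)

theorem contDiffAt_cayley {X : sp n} (h : IsUnit (1 - (X : Mat n))) :
    ContDiffAt ℂ ω (fun X : sp n => (cayley X : Mat n)) X := by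
  have hs : ContDiff ℂ ω (fun X : sp n => (X : Mat n)) := (sp n).subtypeL.contDiff
  have h1 : ContDiffAt ℂ ω
      (fun X : sp n => (1 + (X : Mat n)) * (1 - (X : Mat n))⁻¹) X := by
    refine (contDiffAt_const.add hs.contDiffAt).mul ?_
    exact ContDiffAt.comp X (g := fun A : Mat n => A⁻¹) (contDiffAt_inv h)
      (contDiffAt_const.sub hs.contDiffAt)
  refine h1.congr_of_eventuallyEq ?_
  have ho : ∀ᶠ Y : sp n in 𝓝 X, IsUnit (1 - (Y : Mat n)) :=
    (continuous_const.sub hs.continuous).continuousAt.eventually (Units.isOpen.mem_nhds h)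
  filter_upwards [ho] with Y hY using coe_cayley hY

theorem continuousAt_cayley {X : sp n} (h : IsUnit (1 - (X : Mat n))) :
    ContinuousAt (cayley (n := n)) X :=
  Topology.IsInducing.subtypeVal.continuousAt_iff.2 (contDiffAt_cayley h).continuousAt

theorem param_isOpen_image {U : Set (sp n)} (hU : IsOpen U) (hs : U ⊆ Metric.ball 0 1) :
    IsOpen (param '' U) := by
  have h1 : IsOpen (cayley '' U) := by
    rw [isOpen_iff_mem_nhds]
    rintro _ ⟨X, hX, rfl⟩
    have hu := isUnit_cayley_add_one (isUnit_of_mem_ball (hs hX))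
    have hc : Continuous (fun g : Sp n => (g : Mat n)) := continuous_subtype_val
    have h1 : ∀ᶠ g : Sp n in 𝓝 (cayley X), IsUnit ((g : Mat n) + 1) :=
      (hc.add continuous_const).continuousAt.eventually (Units.isOpen.mem_nhds hu)
    have h2 : ∀ᶠ g : Sp n in 𝓝 (cayley X), cayleyInv (g : Mat n) ∈ U := by
      refine ContinuousAt.eventually_mem (f := fun g : Sp n => cayleyInv (g : Mat n)) ?_ ?_
      · exact ContinuousAt.comp (g := cayleyInv (n := n)) (contDiffAt_cayleyInv hu).continuousAt
          hc.continuousAt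
      · rw [cayleyInv_cayley (isUnit_of_mem_ball (hs hX))]
        exact hU.mem_nhds hX
    filter_upwards [h1, h2] with g h1 h2
    exact ⟨_, h2, cayley_cayleyInv h1⟩
  have := QuotientGroup.isOpenMap_coe (N := signs n) _ h1
  rwa [Set.image_image] at this

/-- The chart of `PSp(2n, ℂ)` at the identity: the inverse of `X ↦ ± (1 + X)(1 - X)⁻¹` on the open unit
ball of `sp(2n, ℂ)`. -/
def chartOne (n : ℕ) : OpenPartialHomeomorph (PSp n) (sp n) :=
  (OpenPartialHomeomorph.ofContinuousOpenRestrict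
    (param_injOn.toPartialEquiv param (Metric.ball (0 : sp n) 1))
    (fun _ hX => (QuotientGroup.continuous_mk.continuousAt.comp
      (continuousAt_cayley (isUnit_of_mem_ball hX))).continuousWithinAt)
    (by
      intro U hU
      have := param_isOpen_image (Metric.isOpen_ball.isOpenMap_subtype_val U hU)
        (by rintro _ ⟨X, -, rfl⟩; exact X.2)
      exact (congrArg IsOpen (Set.image_image param Subtype.val U)).mp this)
    Metric.isOpen_ball).symm


theorem param_chartOne {q : PSp n} (hq : q ∈ (chartOne n).source) : param (chartOne n q) = q :=
  (chartOne n).left_inv hq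

theorem chartOne_mem {q : PSp n} (hq : q ∈ (chartOne n).source) :
    chartOne n q ∈ Metric.ball (0 : sp n) 1 :=
  (chartOne n).map_source hq

theorem chartOne_param {X : sp n} (hX : X ∈ Metric.ball (0 : sp n) 1) :
    chartOne n (param X) = X :=
  (chartOne n).right_inv hX

theorem one_mem_source (n : ℕ) : (1 : PSp n) ∈ (chartOne n).source := by
  have h : (chartOne n).symm 0 ∈ (chartOne n).source :=
    (chartOne n).map_target (Metric.mem_ball_self one_pos)
  have e : (chartOne n).symm 0 = 1 := by
    have h0 : cayley (0 : sp n) = 1 := Subtype.ext (by rw [coe_cayley (by simp)]; simp)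
    exact congrArg (QuotientGroup.mk (s := signs n)) h0
  rwa [e] at h

/-- The complex manifold structure of `PSp(2n, ℂ)`: left translates of the chart at the identity. -/
instance (n : ℕ) : ChartedSpace (sp n) (PSp n) where
  atlas := range fun q : PSp n =>
    (Homeomorph.mulLeft q⁻¹).toOpenPartialHomeomorph.trans (chartOne n)
  chartAt q := (Homeomorph.mulLeft q⁻¹).toOpenPartialHomeomorph.trans (chartOne n)
  mem_chart_source q := by simpa using one_mem_source n
  chart_mem_atlas q := mem_range_self q

section smooth

variable {E : Type*} [NormedAddCommGroup E] [NormedSpace ℂ E] {H : Type*} [TopologicalSpace H]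
  {I : ModelWithCorners ℂ E H} {M : Type*} [TopologicalSpace M] [ChartedSpace H M]

theorem contMDiffAt_chartOne {f : M → Sp n} {x : M}
    (hf : ContMDiffAt I 𝓘(ℂ, Mat n) ω (fun y => (f y : Mat n)) x)
    (hx : (f x : PSp n) ∈ (chartOne n).source) :
    ContMDiffAt I 𝓘(ℂ, sp n) ω (fun y => chartOne n (f y : PSp n)) x := by
  set X := chartOne n (f x : PSp n) with hX
  have hXb : X ∈ Metric.ball (0 : sp n) 1 := chartOne_mem hx
  obtain ⟨g, hg, hgx, hgf⟩ : ∃ g : M → Sp n,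
      ContMDiffAt I 𝓘(ℂ, Mat n) ω (fun y => (g y : Mat n)) x ∧ g x = cayley X ∧
      ∀ y, (g y : PSp n) = (f y : PSp n) := by
    rcases mk_eq_mk.1 ((param_chartOne hx).symm : (f x : PSp n) = (cayley X : PSp n)) with h | h
    · exact ⟨f, hf, Subtype.ext h.symm, fun _ => rfl⟩
    · exact ⟨fun y => ⟨-(f y : Mat n), SymplecticGroup.neg_mem (f y).2⟩, hf.neg,
        Subtype.ext h.symm, fun y => mk_eq_mk.2 (Or.inr (neg_neg _).symm)⟩
  have hu : IsUnit ((g x : Mat n) + 1) := by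
    rw [hgx]; exact isUnit_cayley_add_one (isUnit_of_mem_ball hXb)
  have hY : ContMDiffAt I 𝓘(ℂ, sp n) ω (fun y => cayleyInv (g y : Mat n)) x :=
    ContDiffAt.comp_contMDiffAt (g := cayleyInv (n := n)) (contDiffAt_cayleyInv hu) hg
  refine hY.congr_of_eventuallyEq ?_
  have h1 : ∀ᶠ y in 𝓝 x, IsUnit ((g y : Mat n) + 1) :=
    (hg.continuousAt.add continuousAt_const).eventually (Units.isOpen.mem_nhds hu)
  have h2 : ∀ᶠ y in 𝓝 x, cayleyInv (g y : Mat n) ∈ Metric.ball (0 : sp n) 1 := by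
    refine hY.continuousAt.eventually_mem (Metric.isOpen_ball.mem_nhds ?_)
    rwa [hgx, cayleyInv_cayley (isUnit_of_mem_ball hXb)]
  filter_upwards [h1, h2] with y h1 h2
  rw [← hgf y]
  conv_lhs => rw [← cayley_cayleyInv h1]
  exact chartOne_param h2

end smooth

theorem contDiffAt_transition (p q : PSp n) {X : sp n} (hX : X ∈ Metric.ball (0 : sp n) 1)
    (hs : q⁻¹ * (p⁻¹⁻¹ * param X) ∈ (chartOne n).source) :
    ContDiffAt ℂ ω (fun Y : sp n => chartOne n (q⁻¹ * (p⁻¹⁻¹ * param Y))) X := by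
  obtain ⟨a, rfl⟩ := QuotientGroup.mk_surjective p
  obtain ⟨b, rfl⟩ := QuotientGroup.mk_surjective q
  have e (Y : sp n) : (b : PSp n)⁻¹ * ((a : PSp n)⁻¹⁻¹ * param Y) =
      ((b⁻¹ * (a⁻¹⁻¹ * cayley Y) : Sp n) : PSp n) := by
    rw [QuotientGroup.mk_mul, QuotientGroup.mk_mul, QuotientGroup.mk_inv, QuotientGroup.mk_inv,
      QuotientGroup.mk_inv, param]
  simp only [e] at hs ⊢
  refine contMDiffAt_iff_contDiffAt.1
    (contMDiffAt_chartOne (f := fun X => b⁻¹ * (a⁻¹⁻¹ * cayley X)) ?_ hs)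
  exact (contDiffAt_const.mul (contDiffAt_const.mul
    (contDiffAt_cayley (isUnit_of_mem_ball hX)))).contMDiffAt

instance (n : ℕ) : IsManifold 𝓘(ℂ, sp n) ω (PSp n) := by
  refine isManifold_of_contDiffOn _ _ _ ?_
  rintro _ _ ⟨p, rfl⟩ ⟨q, rfl⟩ X ⟨hX, -⟩
  exact (contDiffAt_transition p q hX.1.1 hX.2.2).contDiffWithinAt

section smooth

variable {E : Type*} [NormedAddCommGroup E] [NormedSpace ℂ E] {H : Type*} [TopologicalSpace H]
  {I : ModelWithCorners ℂ E H} {M : Type*} [TopologicalSpace M] [ChartedSpace H M]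

/-- The projection `Sp(2n, ℂ) → PSp(2n, ℂ)` is holomorphic, as seen by maps into it. -/
theorem contMDiffAt_mk {f : M → Sp n} {x : M}
    (hf : ContMDiffAt I 𝓘(ℂ, Mat n) ω (fun y => (f y : Mat n)) x) :
    ContMDiffAt I 𝓘(ℂ, sp n) ω (fun y => (f y : PSp n)) x := by
  rw [contMDiffAt_iff_target]
  refine ⟨QuotientGroup.continuous_mk.continuousAt.comp
    (Topology.IsInducing.subtypeVal.continuousAt_iff.2 hf.continuousAt), ?_⟩
  refine contMDiffAt_chartOne (f := fun y => (f x)⁻¹ * f y) ?_ ?_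
  · exact ContDiff.comp_contMDiffAt (g := fun A : Mat n => (((f x)⁻¹ : Sp n) : Mat n) * A)
      (contDiff_const.mul contDiff_id) hf
  · simpa using one_mem_source n

/-- The projection `Sp(2n, ℂ) → PSp(2n, ℂ)` has local holomorphic sections. -/
theorem exists_section (q : PSp n) : ∃ s : PSp n → Sp n,
    ContMDiffAt 𝓘(ℂ, sp n) 𝓘(ℂ, Mat n) ω (fun y => (s y : Mat n)) q ∧
    ∀ᶠ y in 𝓝 q, (s y : PSp n) = y := by
  obtain ⟨b, rfl⟩ := QuotientGroup.mk_surjective q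
  refine ⟨fun y => b * cayley (chartAt (sp n) (b : PSp n) y), ?_, ?_⟩
  · have hq := chartOne_mem (n := n) (q := (b : PSp n)⁻¹ * b) (by simpa using one_mem_source n)
    have h1 : ContDiffAt ℂ ω (fun X : sp n => (b : Mat n) * (cayley X : Mat n))
        (chartAt (sp n) (b : PSp n) b) :=
      contDiffAt_const.mul (contDiffAt_cayley (isUnit_of_mem_ball hq))
    exact h1.comp_contMDiffAt (contMDiffAt_extChartAt (I := 𝓘(ℂ, sp n)))
  · filter_upwards [(chartAt (sp n) (b : PSp n)).open_source.mem_nhds (mem_chart_source _ _)]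
      with y hy
    have : param (chartOne n ((b : PSp n)⁻¹ * y)) = (b : PSp n)⁻¹ * y := param_chartOne hy.2
    exact (congrArg (fun z => (b : PSp n) * z) this).trans (mul_inv_cancel_left _ _)

end smooth

/-- `PSp(2n, ℂ)` is a complex Lie group. Its Lie algebra is `GroupLieAlgebra 𝓘(ℂ, sp n) (PSp n)`, the
tangent space at the identity. -/
instance (n : ℕ) : LieGroup 𝓘(ℂ, sp n) ω (PSp n) where
  contMDiff_mul := by
    rintro ⟨p, q⟩
    obtain ⟨s, hs, hs'⟩ := exists_section p
    obtain ⟨t, ht, ht'⟩ := exists_section q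
    have h1 := hs.comp (p, q) (contMDiffAt_fst (I := 𝓘(ℂ, sp n)) (J := 𝓘(ℂ, sp n)))
    have h2 := ht.comp (p, q) (contMDiffAt_snd (I := 𝓘(ℂ, sp n)) (J := 𝓘(ℂ, sp n)))
    have h3 := contMDiffAt_mk (f := fun z : PSp n × PSp n => s z.1 * t z.2) (x := (p, q))
      (ContDiff.comp_contMDiffAt (g := fun A : Mat n × Mat n => A.1 * A.2)
        (contDiff_fst.mul contDiff_snd) (h1.prodMk_space h2))
    refine h3.congr_of_eventuallyEq ?_
    filter_upwards [continuousAt_fst.eventually hs', continuousAt_snd.eventually ht'] with z h1 h2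
    rw [QuotientGroup.mk_mul, h1, h2]
  contMDiff_inv := by
    intro p
    obtain ⟨s, hs, hs'⟩ := exists_section p
    have h3 := contMDiffAt_mk (f := fun z : PSp n => (s z)⁻¹) (x := p) (by
      have hu : IsUnit (s p : Mat n) :=
        (isUnit_iff_isUnit_det _).2 (SymplecticGroup.symplectic_det (s p).2)
      simp only [SymplecticGroup.coe_inv']
      exact ContDiffAt.comp_contMDiffAt (g := fun A : Mat n => A⁻¹) (contDiffAt_inv hu) hs)
    refine h3.congr_of_eventuallyEq ?_
    filter_upwards [hs'] with z h1
    rw [QuotientGroup.mk_inv, h1]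


/-- The adjoint action of a Lie group `G` on its Lie algebra: `Ad(g)` is the differential at `1` of
the conjugation `x ↦ g x g⁻¹`. -/
def Ad {𝕜 : Type*} [NontriviallyNormedField 𝕜] {E : Type*} [NormedAddCommGroup E]
    [NormedSpace 𝕜 E] {H : Type*} [TopologicalSpace H] (I : ModelWithCorners 𝕜 E H) {G : Type*}
    [TopologicalSpace G] [ChartedSpace H G] [Group G] (g : G) (X : GroupLieAlgebra I G) :
    GroupLieAlgebra I G :=
  mfderiv I I (fun x : G => g * x * g⁻¹) 1 X

/-- `X` in the Lie algebra of `G` is strongly `Ad_G`-real: `Ad(h) X = -X` for some involution `h` of `G`,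
that is, an element of order at most two. -/
def IsStronglyAdReal {𝕜 : Type*} [NontriviallyNormedField 𝕜] {E : Type*} [NormedAddCommGroup E]
    [NormedSpace 𝕜 E] {H : Type*} [TopologicalSpace H] (I : ModelWithCorners 𝕜 E H) {G : Type*}
    [TopologicalSpace G] [ChartedSpace H G] [Group G] (X : GroupLieAlgebra I G) : Prop :=
  ∃ h : G, h * h = 1 ∧ Ad I h X = -X

end

end SymplecticReality

/-! Everything rests on one skew-involution. By Taussky–Zassenhaus there is an invertible symmetric
S with S X = Xᵀ S. Put h = J S. Symmetry of S makes h Hamiltonian, and J Xᵀ = -X J gives h X = -X h,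
so h is invertible and already reverses X; only its square is wrong.

To normalise h, take a square root s of -h² that is a polynomial in h²
(`Matrix.exists_aeval_sq_eq`), and let g = h s⁻¹. As h² commutes with h and X, so does s, hence g² =
-1 and g X = -X g. As J intertwines h² with its transpose, it intertwines s with sᵀ, so g is still
Hamiltonian. A Hamiltonian g with g² = -1 is symplectic: gᵀ J g = -J g² = J.

In PSp the class of g squares to 1. The Cayley chart is equivariant for conjugation, so in it
conjugation by ± g is the linear map Y ↦ g Y g⁻¹ near 0. Thus Ad is conjugation of matrices, and the
statement for PSp follows from the one for matrices. -/

/-! ### Self-adjointness for a symmetric form (Taussky–Zassenhaus) -/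

open Polynomial in
/-- A cyclic module over `K[X]` carries a linear form that vanishes on no nonzero ideal. -/
theorem Polynomial.exists_linearMap_quotient_nondegenerate {K : Type*} [Field K] {f : K[X]}
    (hf : f ≠ 0) :
    ∃ φ : (K[X] ⧸ Ideal.span {f}) →ₗ[K] K, ∀ a, (∀ b, φ (a * b) = 0) → a = 0 := by
  wlog hm : f.Monic generalizing f
  · have h := this (f := f * C f.leadingCoeff⁻¹)
      (mul_ne_zero hf (by simpa using hf)) (monic_mul_leadingCoeff_inv hf)
    rwa [Ideal.span_singleton_mul_right_unit (isUnit_C.2 (by simpa using hf))] at h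
  let I : Submodule K K[X] := (Ideal.span {f}).restrictScalars K
  -- The form reads the top possible coefficient of the remainder modulo f. Multiplying a nonzero
  -- remainder by a power of X shifts its leading coefficient into that place.
  let ψ : K[X] →ₗ[K] K := lcoeff K (f.natDegree - 1) ∘ₗ modByMonicHom f
  have hψ : ∀ a ∈ I, ψ a = 0 := by
    intro a ha
    have : a %ₘ f = 0 := (modByMonic_eq_zero_iff_dvd hm).2 (Ideal.mem_span_singleton.1 ha)
    simp [ψ, this]
  refine ⟨I.liftQ ψ hψ, fun a h => ?_⟩
  obtain ⟨p, rfl⟩ := Ideal.Quotient.mk_surjective a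
  rw [Ideal.Quotient.eq_zero_iff_mem, Ideal.mem_span_singleton, ← modByMonic_eq_zero_iff_dvd hm]
  by_contra hr
  have hlt : (p %ₘ f).natDegree < f.natDegree := by
    refine natDegree_modByMonic_lt p hm ?_
    rintro rfl
    simp at hr
  set d := (p %ₘ f).natDegree with hd
  have h1 : ψ (p * X ^ (f.natDegree - 1 - d)) = 0 :=
    h (Ideal.Quotient.mk _ (X ^ (f.natDegree - 1 - d)))
  have h2 : (p * X ^ (f.natDegree - 1 - d)) %ₘ f = (p %ₘ f) * X ^ (f.natDegree - 1 - d) := by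
    have h3 : ((p %ₘ f) * X ^ (f.natDegree - 1 - d)) %ₘ f =
        (p %ₘ f) * X ^ (f.natDegree - 1 - d) := by
      -- The shifted remainder has degree deg f - 1, so no further reduction takes place.
      rw [modByMonic_eq_self_iff hm]
      refine degree_lt_degree ?_
      rw [natDegree_mul_X_pow _ hr]
      omega
    rw [← h3]
    refine (modByMonic_eq_of_dvd_sub hm ?_)
    rw [← sub_mul]
    refine Dvd.dvd.mul_right ⟨p /ₘ f, ?_⟩ _
    rw [sub_eq_iff_eq_add, add_comm, modByMonic_add_div]
  have h4 : ψ (p * X ^ (f.natDegree - 1 - d)) = (p %ₘ f).leadingCoeff := by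
    simp only [ψ, LinearMap.comp_apply, modByMonicHom_apply, h2, lcoeff_apply]
    rw [show f.natDegree - 1 = d + (f.natDegree - 1 - d) by omega,
      show d + (f.natDegree - 1 - d) - d = f.natDegree - 1 - d by omega, coeff_mul_X_pow]
    rfl
  rw [h1] at h4
  exact hr (leadingCoeff_eq_zero.1 h4.symm)

open Polynomial DirectSum in
/-- **Taussky–Zassenhaus**: every endomorphism of a finite-dimensional vector space is self-adjoint
for some nondegenerate symmetric bilinear form. -/
theorem Module.End.exists_isSymm_nondegenerate_isSelfAdjoint {K V : Type*} [Field K]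
    [AddCommGroup V] [Module K V] [FiniteDimensional K V] (f : Module.End K V) :
    ∃ B : LinearMap.BilinForm K V, (∀ x y, B x y = B y x) ∧ (∀ x y, B (f x) y = B x (f y)) ∧
      ∀ x, (∀ y, B x y = 0) → x = 0 := by
  classical
  -- With X acting as f, V is a torsion module over a principal ideal domain, hence a sum of cyclic
  -- modules.
  obtain ⟨ι, _, p, hp, k, ⟨e⟩⟩ := Module.equiv_directSum_of_isTorsion
    (Module.AEval.isTorsion_of_finiteDimensional K V f)
  choose φ hφ using fun i =>
    Polynomial.exists_linearMap_quotient_nondegenerate (pow_ne_zero (k i) (hp i).ne_zero)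
  let E (i : ι) : V →ₗ[K] (K[X] ⧸ Ideal.span {p i ^ k i}) :=
    ((DirectSum.component K[X] ι (fun i => K[X] ⧸ Ideal.span {p i ^ k i}) i ∘ₗ
      e.toLinearMap).restrictScalars K) ∘ₗ (Module.AEval.of K V f).toLinearMap
  have hE (i : ι) (x : V) : E i (f x) = Ideal.Quotient.mk _ X * E i x := by
    have h1 : Module.AEval.of K V f (f x) = (X : K[X]) • Module.AEval.of K V f x :=
      (Module.AEval.X_smul_of (R := K) (M := V) f x).symm
    have h2 : E i (f x) = (X : K[X]) • E i x := by
      simp only [E, LinearMap.comp_apply, LinearMap.restrictScalars_apply, LinearEquiv.coe_coe]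
      rw [h1, map_smul, map_smul]
    rw [h2]
    rfl
  -- Each summand is a commutative ring carrying the form (a, b) ↦ φ(ab). It is symmetric, and
  -- multiplication by X is self-adjoint for it.
  let B : LinearMap.BilinForm K V := ∑ i, (((LinearMap.mul K _).compr₂ (φ i)).compl₁₂ (E i) (E i))
  have hB (x y : V) : B x y = ∑ i, φ i (E i x * E i y) := by
    simp [B, LinearMap.sum_apply]
  refine ⟨B, fun x y => ?_, fun x y => ?_, fun x hx => ?_⟩
  · simp only [hB, mul_comm]
  · simp only [hB, hE]
    refine Finset.sum_congr rfl fun i _ => congrArg _ ?_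
    ring
  · have h0 : e (Module.AEval.of K V f x) = 0 := by
      refine DFinsupp.ext fun i => hφ i _ fun b => ?_
      -- Testing against vectors of a single summand isolates the i-th term of the sum.
      have := hx ((Module.AEval.of K V f).symm (e.symm (DirectSum.of _ i b)))
      rw [hB, Finset.sum_eq_single i] at this
      · have hb : E i ((Module.AEval.of K V f).symm (e.symm (DirectSum.of _ i b))) = b := by
          simp only [E, LinearMap.comp_apply, LinearMap.restrictScalars_apply, LinearEquiv.coe_coe,
            LinearEquiv.apply_symm_apply, DirectSum.component]
          exact DirectSum.of_eq_same (β := fun i => K[X] ⧸ Ideal.span {p i ^ k i}) i b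
        rw [hb] at this
        exact this
      · intro j _ hj
        have hb : E j ((Module.AEval.of K V f).symm (e.symm (DirectSum.of _ i b))) = 0 := by
          simp only [E, LinearMap.comp_apply, LinearMap.restrictScalars_apply, LinearEquiv.coe_coe,
            LinearEquiv.apply_symm_apply, DirectSum.component]
          exact DirectSum.of_eq_of_ne _ _ _ hj
        rw [hb, mul_zero, map_zero]
      · simp
    simpa using h0

open Matrix in
/-- **Taussky–Zassenhaus**: every square matrix is conjugate to its transpose by a symmetric
matrix. -/
theorem Matrix.exists_isSymm_isUnit_mul_eq_transpose_mul {K m : Type*} [Field K] [Fintype m]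
    [DecidableEq m] (A : Matrix m m K) :
    ∃ S : Matrix m m K, S.IsSymm ∧ IsUnit S ∧ S * A = Aᵀ * S := by
  obtain ⟨B, h1, h2, h3⟩ :=
    Module.End.exists_isSymm_nondegenerate_isSelfAdjoint (Matrix.toLin' A)
  let S := LinearMap.BilinForm.toMatrix' B
  have hS (x y : m → K) : B x y = x ⬝ᵥ S *ᵥ y := by
    conv_lhs => rw [← Matrix.toBilin'_toMatrix' B]
    rw [Matrix.toBilin'_apply']
  have hSs : S.IsSymm := by
    ext i j
    simp only [Matrix.transpose_apply, S, LinearMap.BilinForm.toMatrix'_apply]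
    exact h1 _ _
  refine ⟨S, hSs, ?_, ?_⟩
  · rw [← Matrix.mulVec_injective_iff_isUnit]
    refine (injective_iff_map_eq_zero S.mulVecLin).2 ?_
    intro x hx
    refine h3 x fun y => ?_
    rw [h1, hS]
    have : S *ᵥ x = 0 := hx
    rw [this, dotProduct_zero]
  · refine Matrix.ext_of_mulVec_single fun j => ?_
    refine dotProduct_eq _ _ fun w => ?_
    have := h2 w (Pi.single j 1)
    simp only [hS, Matrix.toLin'_apply] at this
    rw [dotProduct_comm, dotProduct_comm _ w, ← mulVec_mulVec, ← mulVec_mulVec, ← this,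
      dotProduct_mulVec w, vecMul_transpose]

/-! ### Square roots modulo a polynomial and of matrices -/

open Polynomial in
/-- Modulo a polynomial with nonzero constant term, `X` has a square root. -/
theorem Polynomial.exists_dvd_sq_sub_X {K : Type*} [Field K] [IsAlgClosed K] [NeZero (2 : K)]
    {m : K[X]} (hm : m.eval 0 ≠ 0) : ∃ q : K[X], m ∣ q ^ 2 - X := by
  classical
  have hm0 : m ≠ 0 := by rintro rfl; simp at hm
  choose r hr using fun c : K => IsAlgClosed.exists_pow_nat_eq c (two_pos)
  -- A first approximation: q₀² and X agree at every root of m, so q₀² - X is nilpotent modulo m.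
  let q₀ : K[X] := Lagrange.interpolate m.roots.toFinset id r
  have hq₀ : m ∣ (q₀ ^ 2 - X) ^ m.natDegree := by
    have hdvd (c : K) (hc : c ∈ m.roots) : X - C c ∣ q₀ ^ 2 - X := by
      rw [dvd_iff_isRoot]
      have h : q₀.eval c = r c := Lagrange.eval_interpolate_at_node r (v := id)
        Function.injective_id.injOn (Multiset.mem_toFinset.2 hc)
      rw [IsRoot, eval_sub, eval_pow, h, hr, eval_X, sub_self]
    have hs := IsAlgClosed.splits m
    have h := Multiset.prod_dvd_prod_of_dvd (S := m.roots) (fun c => X - C c) (fun _ => q₀ ^ 2 - X)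
      hdvd
    rw [Multiset.map_const', Multiset.prod_replicate, ← hs.natDegree_eq_card_roots] at h
    conv_lhs => rw [hs.eq_prod_roots]
    rwa [(isUnit_C.2 (isUnit_iff_ne_zero.2 (leadingCoeff_ne_zero.2 hm0))).mul_left_dvd]
  let x := Ideal.Quotient.mk (Ideal.span {m}) q₀
  let t := Ideal.Quotient.mk (Ideal.span {m}) X
  have hn : IsNilpotent (x ^ 2 - t) := by
    refine ⟨m.natDegree, ?_⟩
    rw [← map_pow, ← map_sub, ← map_pow, Ideal.Quotient.eq_zero_iff_mem, Ideal.mem_span_singleton]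
    exact hq₀
  have ht : IsUnit t := by
    have : IsCoprime X m := by
      rw [Irreducible.coprime_iff_not_dvd irreducible_X, X_dvd_iff, coeff_zero_eq_eval_zero]
      exact hm
    obtain ⟨a, b, hab⟩ := this
    refine IsUnit.of_mul_eq_one (Ideal.Quotient.mk _ a) ?_
    rw [← map_mul, ← map_one (Ideal.Quotient.mk _), Ideal.Quotient.eq, Ideal.mem_span_singleton]
    exact ⟨-b, by linear_combination hab⟩
  -- x² is the unit t plus a nilpotent element.
  have hx : IsUnit x := by
    rw [← isUnit_pow_iff two_ne_zero]
    have := hn.isUnit_add_right_of_commute ht (Commute.all _ _)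
    rwa [sub_add_cancel] at this
  have h2 : IsUnit (2 : K[X] ⧸ Ideal.span {m}) := by
    rw [← map_ofNat (algebraMap K (K[X] ⧸ Ideal.span {m})) 2]
    exact (isUnit_iff_ne_zero.2 two_ne_zero).map _
  -- Newton iteration for Y² - t starting at x: the value there is nilpotent and the derivative 2x
  -- is a unit.
  obtain ⟨y, ⟨-, hy⟩, -⟩ := existsUnique_nilpotent_sub_and_aeval_eq_zero
    (P := (X ^ 2 - C t : (K[X] ⧸ Ideal.span {m})[X])) (x := x) (by simpa using hn)
    (by simpa [one_add_one_eq_two] using h2.mul hx)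
  obtain ⟨q, rfl⟩ := Ideal.Quotient.mk_surjective y
  refine ⟨q, ?_⟩
  rw [← Ideal.mem_span_singleton, ← Ideal.Quotient.eq_zero_iff_mem]
  simpa using hy

open Polynomial in
/-- An invertible matrix has a square root that is a polynomial in it. -/
theorem Matrix.exists_aeval_sq_eq {K m : Type*} [Field K] [IsAlgClosed K] [NeZero (2 : K)]
    [Fintype m] [DecidableEq m] {A : Matrix m m K} (hA : IsUnit A) :
    ∃ q : K[X], aeval A q ^ 2 = A := by
  have h : A.charpoly.eval 0 ≠ 0 := by
    rw [Matrix.eval_charpoly]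
    simpa [Matrix.det_neg] using (A.isUnit_iff_isUnit_det.1 hA).ne_zero
  obtain ⟨q, c, hc⟩ := Polynomial.exists_dvd_sq_sub_X h
  refine ⟨q, ?_⟩
  have := congrArg (aeval A) hc
  rwa [map_mul, Matrix.aeval_self_charpoly, zero_mul, map_sub, map_pow, aeval_X, sub_eq_zero] at this

open Polynomial in
theorem Matrix.transpose_aeval {R m : Type*} [CommRing R] [Fintype m] [DecidableEq m]
    (A : Matrix m m R) (p : R[X]) : (aeval A p).transpose = aeval A.transpose p := by
  simp only [aeval_eq_sum_range, Matrix.transpose_sum, Matrix.transpose_smul, Matrix.transpose_pow]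

-- Intertwining relations survive sums, powers and scalars. This carries both commutation with h²
-- and the relation between J and transposes over to the square root.
open Polynomial in
theorem SemiconjBy.aeval {R A : Type*} [CommSemiring R] [Semiring A] [Algebra R A] {a x y : A}
    (h : SemiconjBy a x y) (p : R[X]) : SemiconjBy a (aeval x p) (aeval y p) := by
  induction p using Polynomial.induction_on' with
  | add p q hp hq => simpa using hp.add_right hq
  | monomial k r =>
    rw [aeval_monomial, aeval_monomial]
    exact SemiconjBy.mul_right (Algebra.commutes r a).symm (h.pow_right k)

/-! ### The symplectic skew-involution -/

namespace SymplecticReality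

open Matrix

variable {n : ℕ}

theorem isUnit_J (n : ℕ) : IsUnit (J (Fin n) ℂ) :=
  (isUnit_iff_isUnit_det _).2 (isUnit_det_J (Fin n) ℂ)

/-- A Hamiltonian matrix anticommutes with an invertible Hamiltonian matrix. -/
theorem exists_isUnit_mem_sp_anticommute {X : Mat n} (hX : X ∈ sp n) :
    ∃ h ∈ sp n, IsUnit h ∧ h * X = -(X * h) := by
  obtain ⟨S, hS, hu, hc⟩ := Matrix.exists_isSymm_isUnit_mul_eq_transpose_mul X
  refine ⟨J (Fin n) ℂ * S, ?_, (isUnit_J n).mul hu, ?_⟩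
  · rw [mem_sp, transpose_mul, hS.eq, J_transpose, Matrix.mul_assoc, neg_mul, J_squared,
      ← Matrix.mul_assoc, J_squared]
    simp
  · have h := mem_sp.1 hX
    have h' : J (Fin n) ℂ * Xᵀ = -(X * J (Fin n) ℂ) := by
      have := congrArg (fun A => J (Fin n) ℂ * A * J (Fin n) ℂ) h
      simp only [mul_neg, neg_mul, Matrix.mul_assoc, J_squared] at this
      simp only [← Matrix.mul_assoc, J_squared] at this
      rw [← neg_eq_iff_eq_neg]
      simpa using this
    rw [Matrix.mul_assoc, hc, ← Matrix.mul_assoc, h', neg_mul, Matrix.mul_assoc]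

/-- A Hamiltonian matrix is conjugate to its negative by a symplectic skew-involution. -/
theorem exists_skewInvolution {X : Mat n} (hX : X ∈ sp n) :
    ∃ g : Sp n, (g : Mat n) ^ 2 = -1 ∧ (g : Mat n) * X * ((g⁻¹ : Sp n) : Mat n) = -X := by
  obtain ⟨h, hh, hu, hc⟩ := exists_isUnit_mem_sp_anticommute hX
  obtain ⟨q, hq⟩ := Matrix.exists_aeval_sq_eq (hu.pow 2).neg
  set s := Polynomial.aeval (-h ^ 2) q with hs
  have hsu : IsUnit s := (isUnit_pow_iff two_ne_zero).1 (hq ▸ (hu.pow 2).neg)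
  have hsh : Commute h s := SemiconjBy.aeval ((Commute.refl h).pow_right 2).neg_right q
  -- Moving X past h twice changes the sign twice.
  have hX2 : Commute X (h ^ 2) := by
    rw [commute_iff_eq, pow_two, ← mul_assoc, mul_assoc h h X, hc]
    rw [mul_neg, ← mul_assoc, hc, neg_mul, neg_neg]
  have hsX : Commute X s := SemiconjBy.aeval hX2.neg_right q
  have hJs : SemiconjBy (J (Fin n) ℂ) s sᵀ := by
    have h1 : J (Fin n) ℂ * h = -(hᵀ * J (Fin n) ℂ) := by rw [mem_sp.1 hh, neg_neg]
    have h2 : SemiconjBy (J (Fin n) ℂ) (-h ^ 2) (-h ^ 2)ᵀ := by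
      rw [SemiconjBy, transpose_neg, transpose_pow, mul_neg, neg_mul, pow_two, pow_two,
        ← mul_assoc, h1, neg_mul, mul_assoc, h1, mul_neg, ← mul_assoc, neg_neg]
    have h3 := SemiconjBy.aeval h2 q
    rwa [← transpose_aeval] at h3
  obtain ⟨u, hu'⟩ := hsu
  have hi : Commute h (↑u⁻¹ : Mat n) := (hu' ▸ hsh).units_inv_right
  have hiX : Commute X (↑u⁻¹ : Mat n) := (hu' ▸ hsX).units_inv_right
  have hsq : (h * (↑u⁻¹ : Mat n)) ^ 2 = (-1 : Mat n) := by
    have h2 : h ^ 2 = -(u : Mat n) ^ 2 := by rw [hu', hq, neg_neg]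
    rw [hi.mul_pow, h2, neg_mul, ← Units.val_pow_eq_pow_val, ← Units.val_pow_eq_pow_val, inv_pow,
      Units.mul_inv]
  have hJu : J (Fin n) ℂ * (↑u⁻¹ : Mat n) = (↑u⁻¹ : Mat n)ᵀ * J (Fin n) ℂ := by
    have h1 : (↑u⁻¹ : Mat n)ᵀ * sᵀ = 1 := by
      rw [← transpose_mul, ← hu', Units.mul_inv, transpose_one]
    calc J (Fin n) ℂ * (↑u⁻¹ : Mat n) = (↑u⁻¹ : Mat n)ᵀ * (sᵀ * J (Fin n) ℂ) * (↑u⁻¹ : Mat n) := by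
          rw [← mul_assoc _ sᵀ, h1, one_mul]
      _ = (↑u⁻¹ : Mat n)ᵀ * J (Fin n) ℂ := by
          rw [← hJs.eq, mul_assoc, mul_assoc, ← hu', Units.mul_inv, mul_one]
  have hmem : h * (↑u⁻¹ : Mat n) ∈ Sp n := by
    -- The product is again Hamiltonian; together with `hsq` this makes it symplectic.
    have h1 : (h * (↑u⁻¹ : Mat n))ᵀ * J (Fin n) ℂ = -(J (Fin n) ℂ * (h * (↑u⁻¹ : Mat n))) := by
      rw [hi.eq, transpose_mul, mul_assoc, ← hJu, ← mul_assoc, mem_sp.1 hh, neg_mul, mul_assoc,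
        hi.eq]
    rw [SymplecticGroup.mem_iff', h1, neg_mul, mul_assoc, ← pow_two, hsq, mul_neg, mul_one, neg_neg]
  let g : Sp n := ⟨h * (↑u⁻¹ : Mat n), hmem⟩
  have hgX : (g : Mat n) * X = -X * g := by
    change h * (↑u⁻¹ : Mat n) * X = -X * (h * (↑u⁻¹ : Mat n))
    rw [mul_assoc, ← hiX.eq, ← mul_assoc, hc, neg_mul, neg_mul, mul_assoc]
  refine ⟨g, hsq, ?_⟩
  have hgi : (g : Mat n) * ((g⁻¹ : Sp n) : Mat n) = 1 := congrArg Subtype.val (mul_inv_cancel g)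
  rw [hgX, mul_assoc, hgi, mul_one]

end SymplecticReality

/-! ### The adjoint action of PSp in the Cayley chart -/

namespace SymplecticReality

open Matrix Topology

variable {n : ℕ}

theorem coe_mul_coe_inv (g : Sp n) : (g : Mat n) * ((g⁻¹ : Sp n) : Mat n) = 1 :=
  congrArg Subtype.val (mul_inv_cancel g)

theorem coe_inv_mul_coe (g : Sp n) : ((g⁻¹ : Sp n) : Mat n) * (g : Mat n) = 1 :=
  congrArg Subtype.val (inv_mul_cancel g)

theorem transpose_mul_J (g : Sp n) :
    (g : Mat n)ᵀ * J (Fin n) ℂ = J (Fin n) ℂ * ((g⁻¹ : Sp n) : Mat n) :=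
  calc (g : Mat n)ᵀ * J (Fin n) ℂ
      = ((g : Mat n)ᵀ * J (Fin n) ℂ * g) * ((g⁻¹ : Sp n) : Mat n) := by
        rw [mul_assoc _ (g : Mat n), coe_mul_coe_inv, mul_one]
    _ = _ := by rw [SymplecticGroup.mem_iff'.1 g.2]

theorem conj_mem_sp (g : Sp n) {Y : Mat n} (hY : Y ∈ sp n) :
    (g : Mat n) * Y * ((g⁻¹ : Sp n) : Mat n) ∈ sp n := by
  have hg' := transpose_mul_J g⁻¹
  rw [inv_inv] at hg'
  rw [mem_sp, transpose_mul, transpose_mul, mul_assoc, mul_assoc, transpose_mul_J g, ← mul_assoc Yᵀ, mem_sp.1 hY,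
    neg_mul, mul_neg, mul_assoc, ← mul_assoc _ (J (Fin n) ℂ), hg']
  simp only [mul_assoc]

/-- Conjugation by a symplectic matrix, as a linear map on `sp(2n, ℂ)`. -/
noncomputable def conjL (g : Sp n) : sp n →L[ℂ] sp n :=
  LinearMap.toContinuousLinearMap
    { toFun Y := ⟨(g : Mat n) * Y * ((g⁻¹ : Sp n) : Mat n), conj_mem_sp g Y.2⟩
      map_add' A B := Subtype.ext <| by simp [mul_add, add_mul]
      map_smul' c A := Subtype.ext <| by simp }

theorem coe_conjL (g : Sp n) (Y : sp n) :
    (conjL g Y : Mat n) = (g : Mat n) * Y * ((g⁻¹ : Sp n) : Mat n) := rfl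

/-- The Cayley transform is equivariant for conjugation. -/
theorem cayley_conjL (g : Sp n) {Y : sp n} (h : IsUnit (1 - (Y : Mat n))) :
    cayley (conjL g Y) = g * cayley Y * g⁻¹ := by
  have e1 : 1 - (conjL g Y : Mat n) = (g : Mat n) * (1 - Y) * ((g⁻¹ : Sp n) : Mat n) := by
    rw [mul_sub, sub_mul, mul_one, coe_mul_coe_inv, coe_conjL]
  have e2 : 1 + (conjL g Y : Mat n) = (g : Mat n) * (1 + Y) * ((g⁻¹ : Sp n) : Mat n) := by
    rw [mul_add, add_mul, mul_one, coe_mul_coe_inv, coe_conjL]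
  have hd := (isUnit_iff_isUnit_det _).1 h
  have e3 : ((g : Mat n) * (1 - Y) * ((g⁻¹ : Sp n) : Mat n)) *
      ((g : Mat n) * (1 - (Y : Mat n))⁻¹ * ((g⁻¹ : Sp n) : Mat n)) = 1 := by
    calc _ = (g : Mat n) * ((1 - Y) * ((((g⁻¹ : Sp n) : Mat n) * g) * (1 - (Y : Mat n))⁻¹)) *
          ((g⁻¹ : Sp n) : Mat n) := by simp only [mul_assoc]
      _ = 1 := by
        rw [coe_inv_mul_coe, one_mul, mul_nonsing_inv _ hd, mul_one, coe_mul_coe_inv]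
  have hu : IsUnit (1 - (conjL g Y : Mat n)) := e1 ▸ IsUnit.of_mul_eq_one _ e3
  refine Subtype.ext ?_
  rw [coe_cayley hu, e1, e2, Matrix.inv_eq_right_inv e3, Submonoid.coe_mul, Submonoid.coe_mul,
    coe_cayley h]
  calc _ = (g : Mat n) * ((1 + Y) * ((((g⁻¹ : Sp n) : Mat n) * g) * (1 - (Y : Mat n))⁻¹)) *
          ((g⁻¹ : Sp n) : Mat n) := by simp only [mul_assoc]
    _ = _ := by rw [coe_inv_mul_coe, one_mul]

theorem chartOne_one : chartOne n 1 = 0 := by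
  have h0 : cayley (0 : sp n) = 1 := Subtype.ext (by rw [coe_cayley (by simp)]; simp)
  have h : param (0 : sp n) = 1 := congrArg (QuotientGroup.mk (s := signs n)) h0
  rw [← h, chartOne_param (Metric.mem_ball_self one_pos)]

/-- In the chart at the identity, conjugation by `± g` is conjugation by `g` on `sp(2n, ℂ)`. -/
theorem chartOne_conj_param (g : Sp n) {Y : sp n} (hY : Y ∈ Metric.ball (0 : sp n) 1)
    (hgY : conjL g Y ∈ Metric.ball (0 : sp n) 1) :
    chartOne n ((g : PSp n) * param Y * (g : PSp n)⁻¹) = conjL g Y := by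
  have : (g : PSp n) * param Y * (g : PSp n)⁻¹ = param (conjL g Y) := by
    rw [param, param, cayley_conjL g (isUnit_of_mem_ball hY), QuotientGroup.mk_mul,
      QuotientGroup.mk_mul, QuotientGroup.mk_inv]
  rw [this, chartOne_param hgY]

/-- The chart expression of conjugation agrees near 0 with a linear map, which is its own
derivative. -/
theorem hasMFDerivAt_conj (g : Sp n) :
    HasMFDerivAt 𝓘(ℂ, sp n) 𝓘(ℂ, sp n)
      (fun x : PSp n => (g : PSp n) * x * (g : PSp n)⁻¹) 1 (conjL g) := by
  refine ⟨by fun_prop, ?_⟩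
  have h1 : extChartAt 𝓘(ℂ, sp n) (1 : PSp n) 1 = (0 : sp n) := by
    change chartOne n (1⁻¹ * 1) = 0
    rw [inv_one, one_mul, chartOne_one]
  rw [h1]
  refine HasFDerivAt.hasFDerivWithinAt ?_
  refine (conjL g).hasFDerivAt.congr_of_eventuallyEq ?_
  have hb : Metric.ball (0 : sp n) 1 ∈ 𝓝 (0 : sp n) := Metric.ball_mem_nhds _ one_pos
  -- Conjugation need not preserve the unit ball, so Y is shrunk until its conjugate lies in the
  -- chart's target.
  have hb' : ∀ᶠ Y in 𝓝 (0 : sp n), conjL g Y ∈ Metric.ball (0 : sp n) 1 :=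
    (conjL g).continuous.continuousAt.eventually_mem (by rwa [map_zero])
  filter_upwards [hb, hb'] with Y hY hgY
  -- The charts are left translates of `chartOne`, by 1 at the source and by g 1 g⁻¹ at the target;
  -- both translations turn out trivial.
  change chartOne n (((g : PSp n) * 1 * (g : PSp n)⁻¹)⁻¹ *
    ((g : PSp n) * (1⁻¹⁻¹ * param Y) * (g : PSp n)⁻¹)) = conjL g Y
  rw [mul_one, mul_inv_cancel, inv_one, inv_one, one_mul, one_mul, chartOne_conj_param g hY hgY]

/-- The adjoint action of `PSp(2n, ℂ)` is conjugation on `sp(2n, ℂ)`. -/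
theorem Ad_mk (g : Sp n) (X : sp n) : Ad 𝓘(ℂ, sp n) (g : PSp n) X = conjL g X :=
  DFunLike.congr_fun (hasMFDerivAt_conj g).mfderiv X

theorem isStronglyAdReal (X : GroupLieAlgebra 𝓘(ℂ, sp n) (PSp n)) :
    IsStronglyAdReal 𝓘(ℂ, sp n) X := by
  -- The tangent space at 1 is by definition the model space sp(2n, ℂ).
  let Y : sp n := X
  obtain ⟨g, hg, hX⟩ := exists_skewInvolution Y.2
  refine ⟨g, ?_, (Ad_mk g Y).trans (Subtype.ext hX)⟩
  rw [← QuotientGroup.mk_mul, ← QuotientGroup.mk_one, mk_eq_mk]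
  right
  rw [Submonoid.coe_mul, ← pow_two, hg, neg_neg, Submonoid.coe_one]

end SymplecticReality

theorem theorem1p1 (n : ℕ) :
    (∀ X : SymplecticReality.sp n, ∃ g : SymplecticReality.Sp n,
      (g : SymplecticReality.Mat n) ^ 2 = -1 ∧
      (g : SymplecticReality.Mat n) * X * ((g⁻¹ : SymplecticReality.Sp n) : SymplecticReality.Mat n)
        = -X) ∧
    (∀ X : GroupLieAlgebra 𝓘(ℂ, SymplecticReality.sp n) (SymplecticReality.PSp n),
      SymplecticReality.IsStronglyAdReal 𝓘(ℂ, SymplecticReality.sp n) X) ∧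
    (∀ X : SymplecticReality.sp n, ∃ g : SymplecticReality.Sp n,
      (g : SymplecticReality.Mat n) * X * ((g⁻¹ : SymplecticReality.Sp n) : SymplecticReality.Mat n)
        = -X) :=
  ⟨fun X => SymplecticReality.exists_skewInvolution X.2, SymplecticReality.isStronglyAdReal,
    fun X => (SymplecticReality.exists_skewInvolution X.2).imp fun _ h => h.2⟩
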